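/- Let $X$ be a finite set with $|X|\ge 2$, and let $T_X$ be the regular rooted tree whose vertices are the finite words over $X$ (the root is the empty word, the children of $v$ are the words $vx$, $x\in X$, and the words of length $n$ form the level $X^n$). For $g\in\operatorname{Aut}T_X$ and a vertex $v$, let $g|_v\in\operatorname{Aut}T_X$ be the restriction defined by $g(vw)=g(v)\,g|_v(w)$ for all words $w$. For $H\le\operatorname{Aut}T_X$ let $\operatorname{Stab}_H(n)$ be the subgroup of the elements of $H$ fixing every vertex of level $n$. For a group $H$ with finite generating set $S$, let $\|g\|_S$ be the word length and $B_H^S(n)=\{g\in H:\|g\|_S\le n\}$. Let $H\le \operatorname{Aut}T_X$ be a finitely generated subgroup such that: (i) $H$ is just-infinite: $H$ is infinite and every nontrivial normal subgroup of $H$ has finite index; (ii) $H$ is regular branch: $H$ acts transitively on each level, and there is a finite index subgroup $K\le H$ such that for every family $(k_x)_{x\in X}$ of elements of $K$ there is an element $k\in K$ that fixes the first level and satisfies $k|_x=k_x$ for all $x\in X$, and such that the subgroup of $K$ formed by all these elements (a copy of $K^{X}$) has finite index in $K$; (iii) $H$ is contracting: $g|_v\in H$ for all $g\in H$ and all vertices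 $v$, and for a finite generating set $S$ of $H$ (the choice does not matter) $$\limsup_{n\to\infty}\sqrt[n]{\limsup_{\|g\|_S\to\infty}\ \max_{v\in X^n}\frac{\|g|_v\|_S}{\|g\|_S}}<1;$$ (iv) $H$ has the congruence subgroup property: every finite index subgroup of $H$ contains $\operatorname{Stab}_H(n)$ for some $n\ge 1$. For a finite generating set $S$ of $H$ put $$F_H^S(n)=\max_{1\ne g\in B_H^S(n)}\ \min\{|H:N| : N\lhd H,\ |H:N|<\infty,\ g\notin N\},$$ $$\Phi_H^S(n)=\min\{|H:N| : N\lhd H,\ |H:N|<\infty,\ B_H^S(n)\to H/N\text{ is injective}\}.$$ Then, for every finite generating set $S$ of $H$, both $\Phi_H^S$ and $F_H^S$ are near exponential: for each $f\in\{\Phi_H^S,F_H^S\}$ there are real numbers $a,b>0$ and an integer $C>0$ such that for all integers $n\ge 1$ $$2^{n^{a}}\le f(Cn)\qquad\text{and}\qquad f(n)\le 2^{(Cn)^{b}}.$$ -/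

import Mathlib

open scoped ENNReal

noncomputable section

/-! ## Residual finiteness growth of a group -/

namespace ResidualGrowth

variable {G : Type*} [Group G]

/-- The word length `‖g‖_S`: the least length of a word in the letters `S ∪ S⁻¹` that represents `g`.
(It is used for generating sets `S` only, where such a word exists.) -/
def wordLength (S : Finset G) (g : G) : ℕ :=
  sInf {n : ℕ | ∃ l : List G, l.length = n ∧ (∀ s ∈ l, s ∈ S ∨ s⁻¹ ∈ S) ∧ l.prod = g}

/-- The ball `B_G^S(n)` of radius `n` in the word metric. -/
def wordBall (S : Finset G) (n : ℕ) : Set G := {g | wordLength S g ≤ n}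

/-- The depth function of an element: `D_G(g) = min {|G : N| : N ⊴ G of finite index, g ∉ N}`.
Values are in `ℕ∞`, so that the minimum over the empty set is `⊤`. -/
def depth (g : G) : ℕ∞ :=
  ⨅ (N : Subgroup G) (_ : N.Normal) (_ : N.FiniteIndex) (_ : g ∉ N), (N.index : ℕ∞)

/-- The residual finiteness growth `F_G^S(n)`: the maximum of `D_G(g)` over the nontrivial elements
`g` of the ball of radius `n`. -/
def rfGrowth (S : Finset G) (n : ℕ) : ℕ∞ :=
  ⨆ (g : G) (_ : g ≠ 1) (_ : g ∈ wordBall S n), depth g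

/-- The full residual finiteness growth `Φ_G^S(n)`: the least order of a finite quotient `G ⧸ N`
such that the ball of radius `n` injects into it. -/
def fullRFGrowth (S : Finset G) (n : ℕ) : ℕ∞ :=
  ⨅ (N : Subgroup G) (_ : N.Normal) (_ : N.FiniteIndex)
    (_ : Set.InjOn (fun g : G => (g : G ⧸ N)) (wordBall S n)), (N.index : ℕ∞)

/-- The comparison `f ≼ g` of growth functions: `f(n) ≤ g(Cn)` for some constant `C > 0`
and all `n ≥ 1`. -/
def GrowthLE (f g : ℕ → ℝ≥0∞) : Prop :=
  ∃ C : ℕ, 0 < C ∧ ∀ n : ℕ, 1 ≤ n → f n ≤ g (C * n)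

/-- The function `n ↦ 2^(n^c)`. -/
def expPow (c : ℝ) (n : ℕ) : ℝ≥0∞ := (2 : ℝ≥0∞) ^ ((n : ℝ) ^ c)

/-- A growth function is near exponential if, with respect to `≼`, it is bounded below and above by
functions of the form `2^(n^c)` with `c > 0`. -/
def NearExponential (f : ℕ → ℕ∞) : Prop :=
  (∃ c : ℝ, 0 < c ∧ GrowthLE (expPow c) (fun n => (f n : ℝ≥0∞))) ∧
  (∃ c : ℝ, 0 < c ∧ GrowthLE (fun n => (f n : ℝ≥0∞)) (expPow c))

/-- A group is just-infinite if it is infinite and all its proper quotients are finite. -/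
def JustInfinite (G : Type*) [Group G] : Prop :=
  Infinite G ∧ ∀ N : Subgroup G, N.Normal → N ≠ ⊥ → N.FiniteIndex

end ResidualGrowth

/-! ## Groups of automorphisms of the regular rooted tree of finite words -/

namespace RootedTree

open ResidualGrowth

variable {X : Type*}

/-- The automorphisms of the rooted tree `T_X`. The vertices are the finite words over `X`, the root
is the empty word, and the children of `v` are the words `v ++ [x]`, `x ∈ X`. An automorphism is a
permutation of the vertices that fixes the root and maps children of `v` to children of the
image of `v`. -/
def autSubgroup (X : Type*) : Subgroup (Equiv.Perm (List X)) where
  carrier := {g | g [] = [] ∧ ∀ v x, ∃ y, g (v ++ [x]) = g v ++ [y]}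
  one_mem' := ⟨rfl, fun _ x => ⟨x, rfl⟩⟩
  mul_mem' := by
    rintro a b ⟨ha, ha'⟩ ⟨hb, hb'⟩
    refine ⟨by simp [hb, ha], fun v x => ?_⟩
    obtain ⟨y, hy⟩ := hb' v x
    obtain ⟨z, hz⟩ := ha' (b v) y
    exact ⟨z, by simp [hy, hz]⟩
  inv_mem' := by
    rintro a ⟨ha, ha'⟩
    refine ⟨by rw [Equiv.Perm.inv_eq_iff_eq, ha], fun u x => ?_⟩
    obtain ⟨w, hw⟩ : ∃ w, a w = u ++ [x] := a.surjective _
    rcases List.eq_nil_or_concat' w with rfl | ⟨v, z, rfl⟩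
    · simp [ha] at hw
    · obtain ⟨y, hy⟩ := ha' v z
      have h : a v ++ [y] = u ++ [x] := hy ▸ hw
      have h1 : a v = u := (List.append_inj' h rfl).1
      refine ⟨z, ?_⟩
      rw [← hw, ← h1]
      simp

/-- The automorphism group `Aut T_X`. -/
abbrev TreeAut (X : Type*) : Type _ := autSubgroup X

/-- The image of a vertex under an automorphism. -/
instance : CoeFun (TreeAut X) (fun _ => List X → List X) := ⟨fun g => (g : Equiv.Perm (List X))⟩

theorem apply_append (g : TreeAut X) (v w : List X) :
    ∃ u, u.length = w.length ∧ g (v ++ w) = g v ++ u := by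
  induction w using List.reverseRecOn with
  | nil => exact ⟨[], rfl, by simp⟩
  | append_singleton w x ih =>
    obtain ⟨u, hu, h⟩ := ih
    obtain ⟨y, hy⟩ := g.2.2 (v ++ w) x
    refine ⟨u ++ [y], by simp [hu], ?_⟩
    rw [← List.append_assoc, hy, h, List.append_assoc]

theorem length_apply (g : TreeAut X) (v : List X) : (g v).length = v.length := by
  obtain ⟨u, hu, h⟩ := apply_append g [] v
  rw [g.2.1] at h
  simpa [hu] using congrArg List.length h

theorem apply_append_eq (g : TreeAut X) (v w : List X) :
    g (v ++ w) = g v ++ (g (v ++ w)).drop v.length := by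
  obtain ⟨u, _, h⟩ := apply_append g v w
  rw [h, ← length_apply g v]
  simp

/-- The restriction `g|_v`, the automorphism of `T_X` with `g (v ++ w) = g v ++ g|_v w`. -/
def restr (g : TreeAut X) (v : List X) : TreeAut X :=
  ⟨{ toFun := fun w => (g (v ++ w)).drop v.length
     invFun := fun w => (g⁻¹ (g v ++ w)).drop v.length
     left_inv := fun w => by
      show List.drop v.length (g⁻¹ (g v ++ List.drop v.length (g (v ++ w)))) = w
      rw [← apply_append_eq]
      simp
     right_inv := fun w => by
      show List.drop v.length (g (v ++ List.drop v.length (g⁻¹ (g v ++ w)))) = w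
      have h := apply_append_eq g⁻¹ (g v) w
      have h2 : g⁻¹ (g v) = v := by simp
      rw [length_apply, h2] at h
      rw [← h]
      simp [length_apply] }, by
    constructor
    · show List.drop v.length (g (v ++ [])) = []
      rw [List.append_nil, ← length_apply g v, List.drop_length]
    · intro w x
      show ∃ y, List.drop v.length (g (v ++ (w ++ [x]))) = List.drop v.length (g (v ++ w)) ++ [y]
      obtain ⟨y, hy⟩ := g.2.2 (v ++ w) x
      refine ⟨y, ?_⟩
      rw [← List.append_assoc, hy, List.drop_append_of_le_length]
      simp [length_apply]⟩

theorem apply_append_restr (g : TreeAut X) (v w : List X) : g (v ++ w) = g v ++ restr g v w :=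
  apply_append_eq g v w

theorem restr_mul (g h : TreeAut X) (v : List X) :
    restr (g * h) v = restr g (h v) * restr h v := by
  apply Subtype.ext
  apply Equiv.ext
  intro w
  have h1 := apply_append_restr (g * h) v w
  have h2 : (g * h) (v ++ w) = g (h v) ++ restr g (h v) (restr h v w) := by
    rw [← apply_append_restr, ← apply_append_restr]
    rfl
  rw [h2] at h1
  exact (List.append_cancel_left h1).symm

theorem restr_one (v : List X) : restr (1 : TreeAut X) v = 1 := by
  have h := restr_mul (1 : TreeAut X) 1 v
  rw [mul_one] at h
  exact (mul_eq_left.mp h.symm)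

/-- The stabilizer in `Aut T_X` of all the vertices of the `n`th level. -/
def levelStab (X : Type*) (n : ℕ) : Subgroup (TreeAut X) where
  carrier := {g | ∀ v : List X, v.length = n → g v = v}
  one_mem' := fun _ _ => rfl
  mul_mem' := by
    intro a b ha hb v hv
    show a (b v) = v
    rw [hb v hv, ha v hv]
  inv_mem' := by
    intro a ha v hv
    have h : a⁻¹ (a v) = v := by simp
    rwa [ha v hv] at h

/-- The group `G` acts transitively on each level of the tree. -/
def LevelTransitive (G : Subgroup (TreeAut X)) : Prop :=
  ∀ v w : List X, v.length = w.length → ∃ g ∈ G, g v = w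

/-- The subgroup `K^X` of `Aut T_X`: the automorphisms `(k_x)_{x ∈ X}` that fix the first level and
whose restrictions `k_x` on the vertices of the first level belong to `K`. -/
def geomPower (K : Subgroup (TreeAut X)) : Subgroup (TreeAut X) where
  carrier := {g | g ∈ levelStab X 1 ∧ ∀ x : X, restr g [x] ∈ K}
  one_mem' := ⟨one_mem _, fun x => by rw [restr_one]; exact one_mem _⟩
  mul_mem' := by
    rintro a b ⟨ha, ha'⟩ ⟨hb, hb'⟩
    refine ⟨mul_mem ha hb, fun x => ?_⟩
    rw [restr_mul, hb [x] rfl]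
    exact mul_mem (ha' x) (hb' x)
  inv_mem' := by
    rintro a ⟨ha, ha'⟩
    refine ⟨inv_mem ha, fun x => ?_⟩
    have h := restr_mul a⁻¹ a [x]
    rw [inv_mul_cancel, restr_one, ha [x] rfl] at h
    rw [eq_inv_of_mul_eq_one_left h.symm]
    exact inv_mem (ha' x)

/-- The subgroup `K` geometrically contains `K^X`: every family `(k_x)_{x ∈ X}` of elements of `K`
is the family of first-level restrictions of an element of `K` that fixes the first level. -/
def GeometricallyContains (K : Subgroup (TreeAut X)) : Prop :=
  ∀ k : X → TreeAut X, (∀ x, k x ∈ K) → ∃ g ∈ K, g ∈ levelStab X 1 ∧ ∀ x, restr g [x] = k x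

/-- A level transitive group `G` is regular branch if it has a finite index subgroup `K` that
geometrically contains `K^X` as a subgroup of finite index. -/
def RegularBranch (G : Subgroup (TreeAut X)) : Prop :=
  LevelTransitive G ∧ ∃ K : Subgroup (TreeAut X), K ≤ G ∧ K.IsFiniteRelIndex G ∧
    GeometricallyContains K ∧ (geomPower K).IsFiniteRelIndex K

/-- The congruence subgroup property: every finite index subgroup of `G` contains
`Stab_G(n)` for some `n ≥ 1`. -/
def CongruenceSubgroupProperty (G : Subgroup (TreeAut X)) : Prop :=
  ∀ L : Subgroup (TreeAut X), L ≤ G → L.IsFiniteRelIndex G →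
    ∃ n : ℕ, 1 ≤ n ∧ G ⊓ levelStab X n ≤ L

/-- A group `G` of automorphisms is self-similar if all the restrictions of its
elements belong to `G`. -/
def SelfSimilar (G : Subgroup (TreeAut X)) : Prop :=
  ∀ g ∈ G, ∀ v : List X, restr g v ∈ G

/-- The contraction coefficient of a self-similar group `G` with finite generating set `S`:
`limsup_{n → ∞} (limsup_{‖g‖ → ∞} max_{v ∈ X^n} ‖g|_v‖ / ‖g‖) ^ (1 / n)`,
computed in `[0, ∞]`. -/
def contractionCoeff (G : Subgroup (TreeAut X)) (hG : SelfSimilar G) (S : Finset G) : ℝ≥0∞ :=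
  Filter.limsup (fun n : ℕ =>
    (Filter.limsup (fun g : G =>
        ⨆ (v : List X) (_ : v.length = n),
          (wordLength S (⟨restr g v, hG g g.2 v⟩ : G) : ℝ≥0∞) / (wordLength S g : ℝ≥0∞))
      (Filter.comap (wordLength S) Filter.atTop)) ^ (1 / (n : ℝ))) Filter.atTop

/-- A finitely generated self-similar group is contracting if its contraction coefficient (with
respect to a finite generating set, whose choice does not matter) is less than `1`. -/
def Contracting (G : Subgroup (TreeAut X)) : Prop :=
  ∃ (hG : SelfSimilar G) (S : Finset G),
    Subgroup.closure (S : Set G) = ⊤ ∧ contractionCoeff G hG S < 1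

end RootedTree

end

open scoped ENNReal

noncomputable section

/-! ### Word metrics and residual growth. -/

namespace ResidualGrowth

variable {G : Type*} [Group G]

/-! Since `rfGrowth` is at most `fullRFGrowth`, it suffices to bound the latter above and the former
below. Upper bound: contraction brings every restriction of an element of length at most `2 ^ i` to
level `k * i` into a fixed finite ball, where a fixed level stabilizer detects nontriviality. Hence
a level stabilizer at depth logarithmic in `n` separates the ball of radius `n`; its index is at
most doubly exponential in the depth (`exists_fullRFGrowth_le`). Lower bound: just-infiniteness
gives `⁅K, K⁆` finite index, so by the congruence property it contains `Stab_H(s)` for some `s`. If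
a normal subgroup `N` moves a vertex of level `m`, transitivity and a double commutator put a copy
of `⁅K, K⁆` below each vertex of that level into `N`, so `N` contains `Stab_H(m + s)`
(`mem_of_not_le_levelStab`). Thus a normal subgroup missing an element of `Stab_H(m + s)` lies in
`Stab_H(m)`, whose index is doubly exponential in `m` by branching (`exists_pow_le_index`). Such
elements of length only exponential in `m` come from iterating the Lipschitz endomorphism `graft
[x]` of `K` (`exists_short_mem_levelStab`). -/

theorem exists_word_length_eq {S : Finset G} (hS : Subgroup.closure (S : Set G) = ⊤) (g : G) :
    ∃ l : List G, l.length = wordLength S g ∧ (∀ s ∈ l, s ∈ S ∨ s⁻¹ ∈ S) ∧ l.prod = g := by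
  obtain ⟨l, hl, hg⟩ := Submonoid.exists_list_of_mem_closure (s := (S : Set G) ∪ (S : Set G)⁻¹)
    (x := g) (by rw [← Subgroup.closure_toSubmonoid, hS]; trivial)
  exact Nat.sInf_mem (s := {n : ℕ | ∃ l : List G, l.length = n ∧
    (∀ s ∈ l, s ∈ S ∨ s⁻¹ ∈ S) ∧ l.prod = g}) ⟨_, l, rfl, by simpa using hl, hg⟩

theorem wordLength_prod_le {S : Finset G} {l : List G} (hl : ∀ s ∈ l, s ∈ S ∨ s⁻¹ ∈ S) :
    wordLength S l.prod ≤ l.length :=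
  Nat.sInf_le ⟨l, rfl, hl, rfl⟩

theorem wordLength_one (S : Finset G) : wordLength S (1 : G) = 0 := by
  simpa using wordLength_prod_le (S := S) (l := []) (by simp)

theorem wordLength_mul_le {S : Finset G} (hS : Subgroup.closure (S : Set G) = ⊤) (g h : G) :
    wordLength S (g * h) ≤ wordLength S g + wordLength S h := by
  obtain ⟨l, hl, hl', rfl⟩ := exists_word_length_eq hS g
  obtain ⟨r, hr, hr', rfl⟩ := exists_word_length_eq hS h
  rw [← hl, ← hr, ← List.prod_append, ← List.length_append]
  refine wordLength_prod_le fun s hs => ?_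
  rcases List.mem_append.mp hs with hs | hs
  exacts [hl' s hs, hr' s hs]

theorem wordLength_inv_le {S : Finset G} (hS : Subgroup.closure (S : Set G) = ⊤) (g : G) :
    wordLength S g⁻¹ ≤ wordLength S g := by
  obtain ⟨l, hl, hl', rfl⟩ := exists_word_length_eq hS g
  rw [← hl, List.prod_inv_reverse]
  refine (wordLength_prod_le fun s hs => ?_).trans (by simp)
  simp only [List.mem_reverse, List.mem_map] at hs
  obtain ⟨t, ht, rfl⟩ := hs
  simpa using (hl' t ht).symm

/-- A homomorphism of finitely generated groups is Lipschitz for the word metrics. -/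
theorem exists_wordLength_map_le {G' : Type*} [Group G'] (f : G →* G') {T : Finset G}
    {S : Finset G'} (hT : Subgroup.closure (T : Set G) = ⊤)
    (hS : Subgroup.closure (S : Set G') = ⊤) :
    ∃ C : ℕ, 0 < C ∧ ∀ g, wordLength S (f g) ≤ C * wordLength T g := by
  -- The sum dominates the image length of each generator; the 1 makes the constant positive.
  set C := 1 + ∑ t ∈ T, wordLength S (f t) with hC
  have hT' : ∀ t ∈ T, wordLength S (f t) ≤ C := fun t ht =>
    (Finset.single_le_sum (f := fun t => wordLength S (f t)) (fun _ _ => Nat.zero_le _) ht).trans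
      (Nat.le_add_left _ _)
  refine ⟨C, by omega, fun g => ?_⟩
  obtain ⟨l, hl, hl', rfl⟩ := exists_word_length_eq hT g
  rw [← hl]
  clear hl
  induction l with
  | nil => simp [wordLength_one]
  | cons s l ih =>
    have hs : wordLength S (f s) ≤ C := by
      rcases hl' s (by simp) with h | h
      · exact hT' s h
      · have := (wordLength_inv_le hS (f s⁻¹)).trans (hT' _ h)
        simpa using this
    rw [List.prod_cons, map_mul, List.length_cons, mul_add, mul_one]
    refine (wordLength_mul_le hS _ _).trans ?_
    rw [add_comm]
    exact Nat.add_le_add (ih fun t ht => hl' t (by simp [ht])) hs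

theorem finite_wordBall {S : Finset G} (hS : Subgroup.closure (S : Set G) = ⊤) (n : ℕ) :
    (wordBall S n).Finite := by
  have hA : {s : G | s ∈ S ∨ s⁻¹ ∈ S}.Finite :=
    S.finite_toSet.union (S.finite_toSet.preimage inv_injective.injOn)
  have := hA.to_subtype
  refine ((List.finite_length_le {s : G | s ∈ S ∨ s⁻¹ ∈ S} n).image
    fun l => (l.map Subtype.val).prod).subset fun g hg => ?_
  obtain ⟨l, hl, hl', rfl⟩ := exists_word_length_eq hS g
  refine ⟨l.attach.map fun s => ⟨s.1, hl' s.1 s.2⟩, ?_, ?_⟩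
  · simpa [hl, wordBall] using hg
  · simp [Function.comp_def]

theorem rfGrowth_le_fullRFGrowth (S : Finset G) (n : ℕ) : rfGrowth S n ≤ fullRFGrowth S n := by
  refine iSup_le fun g => iSup_le fun hg => iSup_le fun hgn => ?_
  refine le_iInf fun N => le_iInf fun hN => le_iInf fun hfin => le_iInf fun hinj => ?_
  refine iInf_le_of_le N (iInf_le_of_le hN (iInf_le_of_le hfin (iInf_le_of_le ?_ le_rfl)))
  intro hgN
  refine hg (hinj hgn (by simp [wordBall, wordLength_one]) ?_)
  exact (QuotientGroup.eq_one_iff g).mpr hgN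

end ResidualGrowth

/-! ### Restrictions, level stabilizers and grafts. -/

namespace RootedTree

open ResidualGrowth

variable {X : Type*}

theorem TreeAut.ext {g h : TreeAut X} (H : ∀ w, g w = h w) : g = h :=
  Subtype.ext (Equiv.ext H)

theorem restr_nil (g : TreeAut X) : restr g [] = g :=
  TreeAut.ext fun _ => rfl

theorem restr_restr (g : TreeAut X) (v w : List X) : restr (restr g v) w = restr g (v ++ w) := by
  refine TreeAut.ext fun u => ?_
  have h := apply_append_restr g (v ++ w) u
  rw [List.append_assoc, apply_append_restr, apply_append_restr g v w,
    apply_append_restr (restr g v) w u, List.append_assoc] at h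
  simpa using h

theorem apply_eq_of_append {g : TreeAut X} {v w : List X} (h : g (v ++ w) = v ++ w) :
    g v = v := by
  rw [apply_append_restr] at h
  exact (List.append_inj h (length_apply g v)).1

theorem levelStab_antitone [Nonempty X] {m n : ℕ} (h : m ≤ n) :
    levelStab X n ≤ levelStab X m := by
  intro g hg v hv
  obtain ⟨x⟩ := ‹Nonempty X›
  exact apply_eq_of_append (hg (v ++ List.replicate (n - m) x) (by simp; omega))

theorem apply_eq_of_mem_levelStab [Nonempty X] {g : TreeAut X} {n : ℕ} (hg : g ∈ levelStab X n)
    {v : List X} (hv : v.length ≤ n) : g v = v :=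
  levelStab_antitone hv hg v rfl

theorem restr_mem_levelStab {g : TreeAut X} {m n : ℕ} (hg : g ∈ levelStab X (m + n)) {v : List X}
    (hv : v.length = m) : restr g v ∈ levelStab X n := by
  intro w hw
  have h := hg (v ++ w) (by simp [hv, hw])
  have h' := apply_append_restr g v w
  rw [h, apply_eq_of_append h] at h'
  exact (List.append_cancel_left h').symm

theorem eq_one_of_restr_eq_one [Nonempty X] {g : TreeAut X} {n : ℕ} (hg : g ∈ levelStab X n)
    (h : ∀ v : List X, v.length = n → restr g v = 1) : g = 1 := by
  refine TreeAut.ext fun w => ?_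
  rcases le_total w.length n with hw | hw
  · exact apply_eq_of_mem_levelStab hg hw
  · have hv : (w.take n).length = n := by simpa using hw
    have := apply_append_restr g (w.take n) (w.drop n)
    rw [h _ hv, hg _ hv, List.take_append_drop] at this
    rw [this]
    exact List.take_append_drop n w

theorem exists_mem_levelStab_imp_eq_one [Nonempty X] {A : Set (TreeAut X)} (hA : A.Finite) :
    ∃ n, ∀ g ∈ A, g ∈ levelStab X n → g = 1 := by
  have h : ∀ g : TreeAut X, ∃ n, g ∈ levelStab X n → g = 1 := by
    intro g
    by_cases hg : ∀ w, g w = w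
    · exact ⟨0, fun _ => TreeAut.ext hg⟩
    · push Not at hg
      obtain ⟨w, hw⟩ := hg
      exact ⟨w.length, fun h => absurd (h w rfl) hw⟩
  choose f hf using h
  obtain ⟨n, hn⟩ := (hA.image f).bddAbove
  exact ⟨n, fun g hg hgn => hf g (levelStab_antitone (hn ⟨g, hg, rfl⟩) hgn)⟩

theorem conj_mem_levelStab {g : TreeAut X} {n : ℕ} (hg : g ∈ levelStab X n) (h : TreeAut X) :
    h * g * h⁻¹ ∈ levelStab X n := by
  intro v hv
  change h (g (h⁻¹ v)) = v
  rw [hg _ (by rw [length_apply, hv])]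
  change (h * h⁻¹) v = v
  rw [mul_inv_cancel]
  rfl

/-- The automorphism that fixes the first level and has prescribed restrictions there. -/
def familyAut (k : X → TreeAut X) : TreeAut X :=
  ⟨{ toFun := fun
      | [] => []
      | x :: w => x :: k x w
     invFun := fun
      | [] => []
      | x :: w => x :: (k x)⁻¹ w
     left_inv := by rintro (_ | ⟨x, w⟩) <;> simp
     right_inv := by rintro (_ | ⟨x, w⟩) <;> simp }, by
    refine ⟨rfl, ?_⟩
    rintro (_ | ⟨x, v⟩) y
    · exact ⟨y, by simp [(k y).2.1]⟩
    · obtain ⟨z, hz⟩ := (k x).2.2 v y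
      exact ⟨z, by simp [hz]⟩⟩

theorem familyAut_cons (k : X → TreeAut X) (x : X) (w : List X) :
    familyAut k (x :: w) = x :: k x w := rfl

theorem eq_familyAut {g : TreeAut X} (hg : g ∈ levelStab X 1) :
    g = familyAut fun x => restr g [x] := by
  refine TreeAut.ext fun w => ?_
  cases w with
  | nil => exact g.2.1
  | cons x w =>
    have h := apply_append_restr g [x] w
    rw [hg [x] rfl] at h
    exact h

theorem familyAut_mem {K : Subgroup (TreeAut X)} (hK : GeometricallyContains K)
    {k : X → TreeAut X} (hk : ∀ x, k x ∈ K) : familyAut k ∈ K := by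
  obtain ⟨g, hgK, hg, h⟩ := hK k hk
  have := eq_familyAut hg
  simp only [h] at this
  rwa [← this]

/-- The embedding of `(Aut T_X)^X` into `Aut T_X` as the stabilizer of the first level. -/
def familyHom (X : Type*) : (X → TreeAut X) →* TreeAut X where
  toFun := familyAut
  map_one' := TreeAut.ext fun w => by cases w <;> rfl
  map_mul' := fun _ _ => TreeAut.ext fun w => by cases w <;> rfl

variable [DecidableEq X]

/-- `graft v a` acts as `a` on the subtree below the vertex `v` and trivially elsewhere. -/
def graft : List X → TreeAut X →* TreeAut X
  | [] => MonoidHom.id _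
  | x :: v => ((familyHom X).comp (MonoidHom.mulSingle (fun _ => TreeAut X) x)).comp (graft v)

theorem graft_cons (x : X) (v : List X) (a : TreeAut X) :
    graft (x :: v) a = familyAut (Pi.mulSingle x (graft v a)) := rfl

theorem graft_apply_append (v w : List X) (a : TreeAut X) : graft v a (v ++ w) = v ++ a w := by
  induction v with
  | nil => rfl
  | cons x v ih =>
    rw [graft_cons, List.cons_append, familyAut_cons, Pi.mulSingle_eq_same, ih, List.cons_append]

theorem graft_apply_of_not_prefix {v w : List X} (h : ¬ v <+: w) (a : TreeAut X) :
    graft v a w = w := by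
  induction v generalizing w with
  | nil => simp at h
  | cons x v ih =>
    cases w with
    | nil => rfl
    | cons y w =>
      rw [graft_cons, familyAut_cons]
      by_cases hxy : y = x
      · subst hxy
        rw [Pi.mulSingle_eq_same, ih (by simpa using h)]
      · rw [Pi.mulSingle_eq_of_ne hxy]
        rfl

theorem graft_mem {K : Subgroup (TreeAut X)} (hK : GeometricallyContains K) (v : List X)
    {a : TreeAut X} (ha : a ∈ K) : graft v a ∈ K := by
  induction v with
  | nil => exact ha
  | cons x v ih =>
    rw [graft_cons]
    refine familyAut_mem hK fun y => ?_
    by_cases hxy : y = x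
    · subst hxy
      rwa [Pi.mulSingle_eq_same]
    · rw [Pi.mulSingle_eq_of_ne hxy]
      exact one_mem K

theorem graft_injective (v : List X) : Function.Injective (graft v) := by
  intro a b h
  refine TreeAut.ext fun w => ?_
  have := graft_apply_append v w a
  rw [h, graft_apply_append] at this
  exact (List.append_cancel_left this).symm

theorem graft_mem_levelStab {v : List X} {n : ℕ} {a : TreeAut X} (ha : a ∈ levelStab X n) :
    graft v a ∈ levelStab X (v.length + n) := by
  intro w hw
  by_cases h : v <+: w
  · obtain ⟨t, rfl⟩ := h
    rw [graft_apply_append, ha t (by simpa using hw)]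
  · exact graft_apply_of_not_prefix h a

theorem conj_graft_apply_of_not_prefix (h : TreeAut X) {v w : List X} (hw : ¬ h v <+: w)
    (a : TreeAut X) : (h * graft v a * h⁻¹) w = w := by
  have hv : ¬ v <+: h⁻¹ w := by
    rintro ⟨t, ht⟩
    apply hw
    refine ⟨restr h v t, ?_⟩
    rw [← apply_append_restr, ht]
    change (h * h⁻¹) w = w
    rw [mul_inv_cancel]
    rfl
  change h (graft v a (h⁻¹ w)) = w
  rw [graft_apply_of_not_prefix hv]
  change (h * h⁻¹) w = w
  rw [mul_inv_cancel]
  rfl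

/-- The vertices `v` and `h v` are distinct of equal length, so neither is a prefix of the other and
no vertex lies below both. -/
theorem disjoint_conj_graft {h : TreeAut X} {v : List X} (hv : h v ≠ v) (a b : TreeAut X) :
    Equiv.Perm.Disjoint ((h * graft v a * h⁻¹ : TreeAut X) : Equiv.Perm (List X))
      (graft v b : TreeAut X) := by
  intro w
  by_cases hw : v <+: w
  · refine Or.inl (conj_graft_apply_of_not_prefix h (fun hw' => hv ?_) a)
    exact (List.prefix_of_prefix_length_le hw' hw (length_apply h v).le).eq_of_length
      (length_apply h v)
  · exact Or.inr (graft_apply_of_not_prefix hw b)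

theorem commute_conj_graft {h : TreeAut X} {v : List X} (hv : h v ≠ v) (a b : TreeAut X) :
    Commute (h * graft v a * h⁻¹) (graft v b) :=
  Subtype.ext (disjoint_conj_graft hv a b).commute

/-- A permutation disjoint from itself is trivial. -/
theorem conj_graft_ne {h : TreeAut X} {v : List X} (hv : h v ≠ v) {a : TreeAut X} (ha : a ≠ 1) :
    h * graft v a * h⁻¹ ≠ graft v a := by
  intro he
  have hd := disjoint_conj_graft hv a a
  rw [he] at hd
  refine ha (graft_injective v (TreeAut.ext fun w => ?_))
  rw [map_one]
  exact (hd w).elim id id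

end RootedTree

/-! ### Upper bound from contraction. -/

namespace RootedTree

open ResidualGrowth

variable {X : Type*}

theorem inv_mul_mem_levelStab_iff {g h : TreeAut X} {n : ℕ} :
    g⁻¹ * h ∈ levelStab X n ↔ ∀ v : List X, v.length = n → g v = h v := by
  refine forall₂_congr fun v _ => ?_
  change (g : Equiv.Perm (List X))⁻¹ ((h : Equiv.Perm (List X)) v) = v ↔ _
  rw [Equiv.Perm.inv_eq_iff_eq, eq_comm]

variable (H : Subgroup (TreeAut X)) (n : ℕ)

instance normal_levelStab_subgroupOf : ((levelStab X n).subgroupOf H).Normal :=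
  ⟨fun _ hg h => conj_mem_levelStab hg (h : TreeAut X)⟩

/-- The action on the `n`th level of a representative of a coset of the level stabilizer. -/
def levelAction (q : H ⧸ (levelStab X n).subgroupOf H) (v : List.Vector X n) : List.Vector X n :=
  ⟨(q.out : TreeAut X) v.1, by rw [length_apply, v.2]⟩

theorem levelAction_injective : Function.Injective (levelAction H n) := by
  intro q r h
  rw [← q.out_eq', ← r.out_eq']
  refine QuotientGroup.eq.mpr ?_
  change ((q.out : H) : TreeAut X)⁻¹ * ((r.out : H) : TreeAut X) ∈ levelStab X n
  rw [inv_mul_mem_levelStab_iff]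
  intro v hv
  exact congrArg Subtype.val (congrFun h ⟨v, hv⟩)

instance finiteIndex_levelStab_subgroupOf [Finite X] :
    ((levelStab X n).subgroupOf H).FiniteIndex := by
  have := Finite.of_injective _ (levelAction_injective H n)
  exact Subgroup.finiteIndex_of_finite_quotient

theorem index_levelStab_subgroupOf_le [Fintype X] :
    ((levelStab X n).subgroupOf H).index ≤ 2 ^ Fintype.card X ^ (2 * n) := by
  refine (Nat.card_le_card_of_injective _ (levelAction_injective H n)).trans ?_
  classical
  -- With `Q = |X| ^ n` there are `Q ^ Q` self-maps of the level, and `Q ^ Q ≤ (2 ^ Q) ^ Q`.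
  rw [Nat.card_eq_fintype_card, Fintype.card_fun, card_vector, mul_comm 2, pow_mul, sq, pow_mul 2]
  exact Nat.pow_le_pow_left Nat.lt_two_pow_self.le _

variable {H}

/-- One level `k` whose inner limsup is below 1 suffices: long elements shrink by the factor `c`,
and the finitely many short ones have boundedly long restrictions. -/
theorem exists_contraction_step [Finite X] {T : Finset H} (hH : SelfSimilar H)
    (hT : Subgroup.closure (T : Set H) = ⊤) (hc : contractionCoeff H hH T < 1) :
    ∃ (k R : ℕ) (c : ℝ≥0∞), c < 1 ∧ ∀ (g : H) (v : List X), v.length = k →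
      wordLength T (⟨restr g v, hH g g.2 v⟩ : H) ≤ R ∨
      (wordLength T (⟨restr g v, hH g g.2 v⟩ : H) : ℝ≥0∞) ≤ c * wordLength T g := by
  have h1 := Filter.eventually_lt_of_limsup_lt hc
  obtain ⟨k, hk, hk0⟩ := (h1.and (Filter.eventually_ge_atTop 1)).exists
  have hk' : (0 : ℝ) < 1 / (k : ℝ) := by
    have : (0 : ℝ) < k := by exact_mod_cast hk0
    positivity
  have h2 := lt_of_not_ge fun h => absurd hk (not_lt.mpr (ENNReal.one_le_rpow h hk'))
  obtain ⟨c, hc1, hc2⟩ := exists_between h2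
  have h3 := Filter.eventually_lt_of_limsup_lt hc1
  rw [Filter.eventually_comap, Filter.eventually_atTop] at h3
  obtain ⟨r, hr⟩ := h3
  have hfin : ((fun p : H × List X => wordLength T (⟨restr p.1 p.2, hH p.1 p.1.2 p.2⟩ : H)) ''
      (wordBall T r ×ˢ {v : List X | v.length = k})).Finite :=
    ((finite_wordBall hT r).prod (List.finite_length_eq X k)).image _
  obtain ⟨R, hR⟩ := hfin.bddAbove
  refine ⟨k, R, c, hc2, fun g v hv => ?_⟩
  by_cases hg : wordLength T g ≤ r
  · exact Or.inl (hR ⟨(g, v), ⟨hg, hv⟩, rfl⟩)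
  · right
    have h4 := hr _ (not_le.mp hg).le g rfl
    have h5 := (le_iSup₂ (f := fun (v : List X) (_ : v.length = k) =>
      (wordLength T (⟨restr g v, hH g g.2 v⟩ : H) : ℝ≥0∞) / (wordLength T g : ℝ≥0∞)) v hv).trans
      h4.le
    rwa [ENNReal.div_le_iff (by simp; omega) (by simp)] at h5

theorem Contracting.exists_wordLength_restr_le [Finite X] (h : Contracting H) :
    ∃ (hH : SelfSimilar H) (T : Finset H), Subgroup.closure (T : Set H) = ⊤ ∧
      ∃ k R : ℕ, ∀ (i : ℕ) (g : H) (v : List X), v.length = k * i → wordLength T g ≤ 2 ^ i →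
        wordLength T (⟨restr g v, hH g g.2 v⟩ : H) ≤ R := by
  obtain ⟨hH, T, hT, hc⟩ := h
  refine ⟨hH, T, hT, ?_⟩
  obtain ⟨k, R, c, hc1, hstep⟩ := exists_contraction_step hH hT hc
  have hiter : ∀ (p : ℕ) (g : H) (v : List X), v.length = k * p →
      wordLength T (⟨restr g v, hH g g.2 v⟩ : H) ≤ R ∨
      (wordLength T (⟨restr g v, hH g g.2 v⟩ : H) : ℝ≥0∞) ≤ c ^ p * wordLength T g := by
    intro p
    induction p with
    | zero =>
      intro g v hv
      obtain rfl : v = [] := by simpa using hv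
      right
      simp [restr_nil]
    | succ p ih =>
      intro g v hv
      rw [mul_add, mul_one] at hv
      have hs := hstep ⟨restr g (v.take (k * p)), hH g g.2 _⟩ (v.drop (k * p)) (by simp; omega)
      simp only [restr_restr, List.take_append_drop] at hs
      rcases hs with hs | hs
      · exact Or.inl hs
      rcases ih g (v.take (k * p)) (by simp; omega) with hi | hi
      · left
        have h1 := hs.trans (mul_le_of_le_one_left (zero_le) hc1.le)
        exact (Nat.cast_le.mp h1).trans hi
      · right
        refine hs.trans ?_
        rw [pow_succ', mul_assoc]
        gcongr
  -- Descending `k * p` levels at least halves the length, unless it is already at most `R`.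
  obtain ⟨p, hp⟩ : ∃ p, c ^ p < 2⁻¹ :=
    ((ENNReal.tendsto_pow_atTop_nhds_zero_of_lt_one hc1).eventually_lt_const
      (by simp)).exists
  refine ⟨k * p, max R 1, fun i g v hv hg => ?_⟩
  rcases hiter (p * i) g v (by rw [hv, mul_assoc]) with h | h
  · exact h.trans (le_max_left _ _)
  · refine le_trans ?_ (le_max_right _ _)
    have h1 : c ^ (p * i) * (wordLength T g : ℝ≥0∞) ≤ (2⁻¹) ^ i * (2 ^ i) := by
      rw [pow_mul]
      gcongr
      exact_mod_cast hg
    rw [← mul_pow, ENNReal.inv_mul_cancel (by simp) (by simp), one_pow] at h1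
    exact_mod_cast h.trans h1

theorem exists_fullRFGrowth_le [Fintype X] [Nonempty X] (h : Contracting H) {S : Finset H}
    (hS : Subgroup.closure (S : Set H) = ⊤) :
    ∃ k s c : ℕ, 0 < c ∧ ∀ n i : ℕ, c * n ≤ 2 ^ i →
      fullRFGrowth S n ≤ ((2 ^ Fintype.card X ^ (2 * (k * i + s)) : ℕ) : ℕ∞) := by
  obtain ⟨hH, T, hT, k, R, hR⟩ := h.exists_wordLength_restr_le
  obtain ⟨c, hc, hcS⟩ := exists_wordLength_map_le (MonoidHom.id H) hS hT
  obtain ⟨s, hs⟩ := exists_mem_levelStab_imp_eq_one ((finite_wordBall hT R).image Subtype.val)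
  refine ⟨k, s, 2 * c, by omega, fun n i hi => ?_⟩
  refine iInf_le_of_le ((levelStab X (k * i + s)).subgroupOf H) (iInf_le_of_le inferInstance
    (iInf_le_of_le inferInstance (iInf_le_of_le ?_ ?_)))
  · intro g hg h hh hgh
    have hst : g⁻¹ * h ∈ (levelStab X (k * i + s)).subgroupOf H := QuotientGroup.eq.mp hgh
    have hlen : wordLength T (g⁻¹ * h) ≤ 2 ^ i := by
      refine (hcS _).trans (le_trans ?_ hi)
      have h1 := wordLength_mul_le hS g⁻¹ h
      have h2 := wordLength_inv_le hS g
      have h3 : wordLength S g ≤ n := hg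
      have h4 : wordLength S h ≤ n := hh
      calc c * wordLength S (g⁻¹ * h) ≤ c * (2 * n) := Nat.mul_le_mul_left _ (by omega)
        _ = 2 * c * n := by ring
    -- At level `k * i` each restriction lies in the ball of radius `R` and fixes level `s`, hence
    -- is trivial.
    have h1 : ((g⁻¹ * h : H) : TreeAut X) = 1 := by
      refine eq_one_of_restr_eq_one (n := k * i)
        (levelStab_antitone (Nat.le_add_right _ s) hst) fun v hv => ?_
      exact hs _ ⟨⟨_, hH _ (g⁻¹ * h).2 v⟩, hR i (g⁻¹ * h) v hv hlen, rfl⟩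
        (restr_mem_levelStab hst hv)
    exact inv_mul_eq_one.mp (Subtype.ext h1)
  · exact Nat.cast_le.mpr (index_levelStab_subgroupOf_le H _)

theorem growthLE_fullRFGrowth_expPow [Fintype X] [Nonempty X] (h : Contracting H) {S : Finset H}
    (hS : Subgroup.closure (S : Set H) = ⊤) :
    ∃ b : ℝ, 0 < b ∧ GrowthLE (fun n => (fullRFGrowth S n : ℝ≥0∞)) (expPow b) := by
  obtain ⟨k, s, c, hc, hb⟩ := exists_fullRFGrowth_le h hS
  set q := Fintype.card X with hq
  have hq0 : 0 < q := Fintype.card_pos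
  -- Since `q ≤ 2 ^ q`, the factor `q ^ (2 * k * i)` is at most `(2 ^ i) ^ (2 * k * q)`, with `2 ^ i
  -- ≤ 2 * c * n`; the `+ 1` keeps the exponent positive.
  set b := 2 * k * q + 1 with hbdef
  refine ⟨(b : ℕ), by positivity, q ^ (2 * s) * (2 * c), by positivity, fun n hn => ?_⟩
  have hcn : 0 < c * n := by positivity
  have h1 := hb n (Nat.log 2 (c * n) + 1) (Nat.lt_pow_succ_log_self one_lt_two (c * n)).le
  have h2 : 2 ^ (Nat.log 2 (c * n) + 1) ≤ 2 * (c * n) := by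
    rw [pow_succ']
    exact Nat.mul_le_mul_left 2 (Nat.pow_log_le_self 2 hcn.ne')
  generalize Nat.log 2 (c * n) + 1 = i at h1 h2
  have h3 : q ^ (2 * (k * i + s)) ≤ (q ^ (2 * s) * (2 * c) * n) ^ b := by
    calc q ^ (2 * (k * i + s)) = q ^ (2 * s) * q ^ (2 * k * i) := by rw [← pow_add]; ring_nf
      _ ≤ (q ^ (2 * s)) ^ b * (2 ^ q) ^ (2 * k * i) :=
        Nat.mul_le_mul (Nat.le_self_pow (by omega) _)
          (Nat.pow_le_pow_left Nat.lt_two_pow_self.le _)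
      _ = (q ^ (2 * s)) ^ b * (2 ^ i) ^ (2 * k * q) := by
        rw [← pow_mul 2, ← pow_mul 2]; ring_nf
      _ ≤ (q ^ (2 * s)) ^ b * (2 * (c * n)) ^ b :=
        Nat.mul_le_mul_left _ ((Nat.pow_le_pow_left h2 _).trans
          (Nat.pow_le_pow_right (by positivity) (Nat.le_succ _)))
      _ = _ := by rw [← mul_pow]; ring_nf
  have h4 : fullRFGrowth S n ≤ ((2 ^ (q ^ (2 * s) * (2 * c) * n) ^ b : ℕ) : ℕ∞) :=
    h1.trans (Nat.cast_le.mpr (Nat.pow_le_pow_right (by omega) h3))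
  refine (ENat.toENNReal_le.mpr h4).trans (le_of_eq ?_)
  rw [ENat.toENNReal_coe, expPow, Real.rpow_natCast, ← Nat.cast_pow, ENNReal.rpow_natCast]
  push_cast
  rfl

end RootedTree

/-! ### Lower bound from branching and congruence subgroups. -/

namespace RootedTree

open ResidualGrowth
open scoped commutatorElement

variable {X : Type*}

theorem infinite_of_finiteIndex {G : Type*} [Group G] [Infinite G] (L : Subgroup G)
    [L.FiniteIndex] : Infinite L := by
  by_contra h
  rw [not_infinite_iff_finite] at h
  have h1 := L.card_mul_index
  rw [Nat.card_eq_zero_of_infinite (α := G)] at h1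
  exact (mul_ne_zero Nat.card_pos.ne' Subgroup.FiniteIndex.index_ne_zero) h1

theorem infinite_of_isFiniteRelIndex {G : Type*} [Group G] {K H : Subgroup G} [Infinite H]
    (hKH : K ≤ H) [K.IsFiniteRelIndex H] : Infinite K := by
  have : (K.subgroupOf H).FiniteIndex := ⟨Subgroup.relIndex_ne_zero⟩
  have := infinite_of_finiteIndex (K.subgroupOf H)
  exact (Subgroup.subgroupOfEquivOfLe hKH).toEquiv.infinite_iff.mp this

theorem fg_of_isFiniteRelIndex {G : Type*} [Group G] {K H : Subgroup G} (hH : Group.FG H)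
    (hKH : K ≤ H) [K.IsFiniteRelIndex H] : Group.FG K := by
  have : (K.subgroupOf H).FiniteIndex := ⟨Subgroup.relIndex_ne_zero⟩
  exact Group.fg_of_surjective (f := (Subgroup.subgroupOfEquivOfLe hKH).toMonoidHom)
    (Subgroup.subgroupOfEquivOfLe hKH).surjective

section Graft

variable [DecidableEq X] {H K N : Subgroup (TreeAut X)}

/-- If `N` is normalized by `H ≥ K` and contains an element moving `v`, then `N` contains the copy
of the derived subgroup of `K` below `v`. -/
theorem graft_mem_of_apply_ne (hKH : K ≤ H) (hK : GeometricallyContains K)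
    (hN : ∀ h ∈ H, ∀ g ∈ N, h * g * h⁻¹ ∈ N) {h : TreeAut X} (hh : h ∈ N) {v : List X}
    (hv : h v ≠ v) {a : TreeAut X} (ha : a ∈ ⁅K, K⁆) : graft v a ∈ N := by
  suffices H : ⁅K, K⁆ ≤ N.comap (graft v) from H ha
  rw [Subgroup.commutator_le]
  intro a ha b hb
  have hcomm : Commute (h * (graft v a)⁻¹ * h⁻¹) (graft v b) := by
    rw [← map_inv]
    exact commute_conj_graft hv _ _
  have hA := hN _ (hKH (graft_mem hK v ha))
  have hB := hN _ (hKH (graft_mem hK v hb))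
  have h1 : graft v a * h * (graft v a)⁻¹ * h⁻¹ ∈ N := N.mul_mem (hA h hh) (N.inv_mem hh)
  have h2 := N.mul_mem h1 (hB _ (N.inv_mem h1))
  -- With `A`, `B` the grafts of `a`, `b`, one has `⁅A, h⁆ = A * (h * A⁻¹ * h⁻¹)`. The second factor
  -- commutes with `B`, so `⁅⁅A, h⁆, B⁆ = ⁅A, B⁆`.
  have h3 : graft v ⁅a, b⁆ = ⁅graft v a * (h * (graft v a)⁻¹ * h⁻¹), graft v b⁆ := by
    rw [map_commutatorElement, commutatorElement_def, commutatorElement_def]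
    calc _ = graft v a * (graft v b * (h * (graft v a)⁻¹ * h⁻¹)) * (h * (graft v a)⁻¹ * h⁻¹)⁻¹ *
          (graft v a)⁻¹ * (graft v b)⁻¹ := by group
      _ = _ := by rw [← hcomm.eq]; group
  rw [Subgroup.mem_comap, h3]
  convert h2 using 1
  rw [commutatorElement_def]
  group

/-- An element fixing level `m` is the finite product of the grafts of its restrictions there. The
induction peels off the first letter, replacing `M` by its preimage under `graft [x]`. -/
theorem mem_of_graft_restr_mem [Finite X] {A : Set (TreeAut X)} (m : ℕ) :
    ∀ {M : Subgroup (TreeAut X)} {g : TreeAut X},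
      (∀ w : List X, w.length = m → ∀ a ∈ A, graft w a ∈ M) → g ∈ levelStab X m →
      (∀ w : List X, w.length = m → restr g w ∈ A) → g ∈ M := by
  induction m with
  | zero =>
    intro M g hM _ hA
    have := hM [] rfl _ (hA [] rfl)
    rwa [restr_nil] at this
  | succ m ih =>
    intro M g hM hg hA
    have hg1 : g ∈ levelStab X 1 := by
      intro v hv
      obtain ⟨x, rfl⟩ := List.length_eq_one_iff.mp hv
      exact apply_eq_of_append (w := List.replicate m x) (hg _ (by simp))
    rw [eq_familyAut hg1]
    change (fun x => restr g [x]) ∈ M.comap (familyHom X)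
    refine Subgroup.pi_mem_of_mulSingle_mem _ fun x => ?_
    change restr g [x] ∈ M.comap (graft [x])
    refine ih (fun w hw a ha => ?_) ?_ fun w hw => ?_
    · exact hM (x :: w) (by simp [hw]) a ha
    · exact restr_mem_levelStab (m := 1) (by rwa [add_comm]) rfl
    · rw [restr_restr]
      exact hA _ (by simp [hw])

theorem mem_of_not_le_levelStab [Finite X] [Nonempty X] (hself : SelfSimilar H) (hKH : K ≤ H)
    (hK : GeometricallyContains K) (htr : LevelTransitive H)
    (hN : ∀ h ∈ H, ∀ g ∈ N, h * g * h⁻¹ ∈ N) {s : ℕ} (hs : H ⊓ levelStab X s ≤ ⁅K, K⁆) {m : ℕ}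
    (hm : ¬ N ≤ levelStab X m) {g : TreeAut X} (hgH : g ∈ H) (hg : g ∈ levelStab X (m + s)) :
    g ∈ N := by
  obtain ⟨h, hhN, hh⟩ := SetLike.not_le_iff_exists.mp hm
  obtain ⟨v, hv, hhv⟩ : ∃ v : List X, v.length = m ∧ h v ≠ v := by
    by_contra! hcon
    exact hh hcon
  have hmove : ∀ w : List X, w.length = m → ∃ h' ∈ N, h' w ≠ w := by
    intro w hw
    obtain ⟨t, htH, ht⟩ := htr v w (hv.trans hw.symm)
    refine ⟨t * h * t⁻¹, hN t htH h hhN, fun hfix => hhv ?_⟩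
    have h1 : t (h (t⁻¹ w)) = w := hfix
    have h2 : t⁻¹ w = v := by
      change (t : Equiv.Perm (List X))⁻¹ w = v
      rw [Equiv.Perm.inv_eq_iff_eq, ht]
    rw [h2, ← ht] at h1
    exact (t : Equiv.Perm (List X)).injective h1
  refine mem_of_graft_restr_mem m (A := (⁅K, K⁆ : Subgroup (TreeAut X))) (fun w hw a ha => ?_)
    (levelStab_antitone (Nat.le_add_right m s) hg)
    fun w hw => hs ⟨hself g hgH w, restr_mem_levelStab hg hw⟩
  obtain ⟨h', hh'N, hh'⟩ := hmove w hw
  exact graft_mem_of_apply_ne hKH hK hN hh'N hh' ha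

/-- For the normal core `L` of `K`, it suffices that `⁅L, L⁆` be nontrivial. If `h ∈ L` moves `v`,
it fails to commute with any nontrivial graft at `v`, and `L` contains one because it has finite
index. -/
theorem isFiniteRelIndex_commutator (hji : JustInfinite H) (hKH : K ≤ H)
    [K.IsFiniteRelIndex H] (hK : GeometricallyContains K) : ⁅K, K⁆.IsFiniteRelIndex H := by
  have := hji.1
  have : (K.subgroupOf H).FiniteIndex := ⟨Subgroup.relIndex_ne_zero⟩
  set L := (K.subgroupOf H).normalCore
  have := infinite_of_finiteIndex L
  have := infinite_of_isFiniteRelIndex hKH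
  have hLK : L ≤ K.subgroupOf H := Subgroup.normalCore_le _
  have hne : ⁅L, L⁆ ≠ ⊥ := by
    intro hbot
    obtain ⟨h, hh⟩ := exists_ne (1 : L)
    obtain ⟨v, hv⟩ : ∃ v : List X, (h : TreeAut X) v ≠ v := by
      by_contra! hcon
      exact hh (Subtype.ext (Subtype.ext (TreeAut.ext hcon)))
    let f : K →* H := ((graft v).comp K.subtype).codRestrict H fun k => hKH (graft_mem hK v k.2)
    have : (L.comap f).FiniteIndex := ⟨by
      rw [Subgroup.index_comap]
      exact (inferInstance : (L.subgroupOf f.range).FiniteIndex).index_ne_zero⟩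
    have := infinite_of_finiteIndex (L.comap f)
    obtain ⟨a, ha⟩ := exists_ne (1 : L.comap f)
    have ha' : ((a : K) : TreeAut X) ≠ 1 := fun h => ha (Subtype.ext (Subtype.ext h))
    have h1 : ⁅(h : H), f a⁆ ∈ ⁅L, L⁆ := Subgroup.commutator_mem_commutator h.2 a.2
    rw [hbot, Subgroup.mem_bot, commutatorElement_eq_one_iff_mul_comm] at h1
    refine conj_graft_ne hv ha' ?_
    rw [mul_inv_eq_iff_eq_mul]
    exact congrArg Subtype.val h1
  have hfi := hji.2 ⁅L, L⁆ inferInstance hne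
  have hle : ⁅L, L⁆ ≤ ⁅K, K⁆.subgroupOf H := by
    rw [Subgroup.commutator_le]
    intro a ha b hb
    exact Subgroup.commutator_mem_commutator (hLK ha) (hLK hb)
  exact ⟨(Subgroup.finiteIndex_of_le hle).index_ne_zero⟩

end Graft

/-- Two elements that differ on level `m` start the family. Choosing a member independently below
each letter raises the cardinality to the power `|X|` and uses one more level. -/
theorem exists_family_injective_on_level.{u} {X : Type u} [Finite X] {K : Subgroup (TreeAut X)}
    (hK : GeometricallyContains K) [Infinite K] :
    ∃ m : ℕ, ∀ j : ℕ, ∃ (ι : Type u) (e : ι → TreeAut X), Nat.card ι = 2 ^ Nat.card X ^ j ∧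
      (∀ i, e i ∈ K) ∧ ∀ i i', (e i)⁻¹ * e i' ∈ levelStab X (m + j) → i = i' := by
  obtain ⟨k, hk⟩ := exists_ne (1 : K)
  obtain ⟨v, hv⟩ : ∃ v : List X, (k : TreeAut X) v ≠ v := by
    by_contra! hcon
    exact hk (Subtype.ext (TreeAut.ext hcon))
  refine ⟨v.length, fun j => ?_⟩
  induction j with
  | zero =>
    refine ⟨ULift Bool, fun b => if b.down then k else 1, by simp, fun b => ?_, ?_⟩
    · dsimp only
      split_ifs
      exacts [k.2, one_mem K]
    · rintro ⟨_ | _⟩ ⟨_ | _⟩ h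
      · rfl
      · exact absurd (inv_mul_mem_levelStab_iff.mp h v rfl).symm hv
      · exact absurd (inv_mul_mem_levelStab_iff.mp h v rfl) hv
      · rfl
  | succ j ih =>
    obtain ⟨ι, e, hcard, heK, he⟩ := ih
    refine ⟨X → ι, fun f => familyAut fun x => e (f x), ?_, fun f => familyAut_mem hK fun x =>
      heK _, fun f f' h => funext fun x => he _ _ ?_⟩
    · rw [Nat.card_fun, hcard, ← pow_mul, pow_succ]
    · rw [inv_mul_mem_levelStab_iff] at h ⊢
      intro w hw
      have := h (x :: w) (by simp [hw]; omega)
      rw [familyAut_cons, familyAut_cons] at this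
      exact (List.cons.inj this).2

theorem exists_pow_le_index [Finite X] {H K : Subgroup (TreeAut X)} (hKH : K ≤ H)
    (hK : GeometricallyContains K) [Infinite K] :
    ∃ m : ℕ, ∀ (j : ℕ) (N : Subgroup H), N.FiniteIndex →
      N ≤ (levelStab X (m + j)).subgroupOf H → 2 ^ Nat.card X ^ j ≤ N.index := by
  obtain ⟨m, hm⟩ := exists_family_injective_on_level hK
  refine ⟨m, fun j N hfin hN => ?_⟩
  obtain ⟨ι, e, hcard, heK, he⟩ := hm j
  rw [← hcard]
  -- Finite index matters here: an infinite quotient would have `N.index = 0`.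
  refine Nat.card_le_card_of_injective (fun i => ((⟨e i, hKH (heK i)⟩ : H) : H ⧸ N))
    fun i i' h => he i i' ?_
  exact hN (QuotientGroup.eq.mp h)

theorem exists_short_mem_levelStab [Finite X] [Nonempty X] {H K : Subgroup (TreeAut X)}
    (hfg : Group.FG H) (hKH : K ≤ H) (hK : GeometricallyContains K) [K.IsFiniteRelIndex H]
    [Infinite K] {S : Finset H} (hS : Subgroup.closure (S : Set H) = ⊤) (s : ℕ) :
    ∃ C D : ℕ, 1 < C ∧ ∀ m : ℕ, ∃ g : H, g ≠ 1 ∧ (g : TreeAut X) ∈ levelStab X (m + s) ∧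
      wordLength S g ≤ D * C ^ m := by
  classical
  obtain ⟨x⟩ := ‹Nonempty X›
  obtain ⟨T, hT⟩ := (fg_of_isFiniteRelIndex hfg hKH).1
  let φ : K →* K := ((graft [x]).comp K.subtype).codRestrict K fun k => graft_mem hK [x] k.2
  have hφ : ∀ k, (φ k : TreeAut X) = graft [x] k := fun _ => rfl
  obtain ⟨C, -, hC⟩ := exists_wordLength_map_le φ hT hT
  obtain ⟨D, -, hD⟩ := exists_wordLength_map_le (Subgroup.inclusion hKH) hT hS
  have := infinite_of_finiteIndex ((levelStab X s).subgroupOf K)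
  obtain ⟨k, hk⟩ := exists_ne (1 : (levelStab X s).subgroupOf K)
  -- Enlarging `C` makes it exceed 1, as the logarithms to base `C` below require.
  refine ⟨C + 2, D * wordLength T (k : K), by omega, fun m => ?_⟩
  obtain ⟨g, hg1, hgs, hg⟩ : ∃ g : K, g ≠ 1 ∧ (g : TreeAut X) ∈ levelStab X (m + s) ∧
      wordLength T g ≤ wordLength T (k : K) * (C + 2) ^ m := by
    induction m with
    | zero => exact ⟨k, fun h => hk (Subtype.ext h), by rw [zero_add]; exact k.2, by simp⟩
    | succ m ih =>
      obtain ⟨g, hg1, hgs, hg⟩ := ih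
      refine ⟨φ g, fun h => hg1 ?_, ?_, ?_⟩
      · refine Subtype.ext (graft_injective [x] ?_)
        rw [← hφ, h]
        simp
      · rw [hφ, add_comm m 1, add_assoc]
        exact graft_mem_levelStab (v := [x]) hgs
      · refine (hC g).trans ?_
        calc C * wordLength T g ≤ (C + 2) * (wordLength T (k : K) * (C + 2) ^ m) :=
              Nat.mul_le_mul (by omega) hg
          _ = _ := by ring
  refine ⟨Subgroup.inclusion hKH g, fun h => hg1 ?_, hgs, (hD g).trans ?_⟩
  · exact Subgroup.inclusion_injective hKH (by rw [h, map_one])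
  · rw [mul_assoc]
    exact Nat.mul_le_mul_left _ hg

theorem exists_le_depth [Finite X] [Nonempty X] {H : Subgroup (TreeAut X)} (hfg : Group.FG H)
    (hji : JustInfinite H) (hrb : RegularBranch H) (hself : SelfSimilar H)
    (hcsp : CongruenceSubgroupProperty H) {S : Finset H}
    (hS : Subgroup.closure (S : Set H) = ⊤) :
    ∃ C D : ℕ, 1 < C ∧ ∀ j : ℕ, ∃ g : H, g ≠ 1 ∧ wordLength S g ≤ D * C ^ j ∧
      ((2 ^ Nat.card X ^ j : ℕ) : ℕ∞) ≤ depth g := by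
  classical
  obtain ⟨htr, K, hKH, hfi, hK, -⟩ := hrb
  have := hji.1
  have := infinite_of_isFiniteRelIndex hKH
  obtain ⟨s, -, hs⟩ := hcsp ⁅K, K⁆ ((Subgroup.commutator_le.mpr fun a ha b hb =>
    K.mul_mem (K.mul_mem (K.mul_mem ha hb) (K.inv_mem ha)) (K.inv_mem hb)).trans hKH)
    (isFiniteRelIndex_commutator hji hKH hK)
  obtain ⟨C, D, hC, hshort⟩ := exists_short_mem_levelStab hfg hKH hK hS s
  obtain ⟨m, hm⟩ := exists_pow_le_index hKH hK
  refine ⟨C, D * C ^ m, hC, fun j => ?_⟩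
  -- The depth is `m + j` because the separated family needs `m` extra levels; their cost `C ^ m` is
  -- absorbed into the constant.
  obtain ⟨g, hg1, hgs, hg⟩ := hshort (m + j)
  refine ⟨g, hg1, by rwa [mul_assoc, ← pow_add], ?_⟩
  refine le_iInf fun N => le_iInf fun hN => le_iInf fun hfin => le_iInf fun hgN => ?_
  refine Nat.cast_le.mpr (hm j N hfin ?_)
  by_contra hle
  have hmem := mem_of_not_le_levelStab (N := N.map H.subtype) hself hKH hK htr ?_ hs (m := m + j) ?_
    g.2 hgs
  · obtain ⟨g', hg', he⟩ := hmem
    obtain rfl : g' = g := Subtype.ext he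
    exact hgN hg'
  · rintro h hh _ ⟨g', hg', rfl⟩
    exact ⟨⟨h, hh⟩ * g' * ⟨h, hh⟩⁻¹, hN.conj_mem g' hg' ⟨h, hh⟩, rfl⟩
  · rwa [Subgroup.map_le_iff_le_comap]

theorem growthLE_expPow_rfGrowth [Finite X] [Nontrivial X] {H : Subgroup (TreeAut X)}
    (hfg : Group.FG H) (hji : JustInfinite H) (hrb : RegularBranch H) (hself : SelfSimilar H)
    (hcsp : CongruenceSubgroupProperty H) {S : Finset H}
    (hS : Subgroup.closure (S : Set H) = ⊤) :
    ∃ a : ℝ, 0 < a ∧ GrowthLE (expPow a) (fun n => (rfGrowth S n : ℝ≥0∞)) := by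
  obtain ⟨C, D, hC, hdepth⟩ := exists_le_depth hfg hji hrb hself hcsp hS
  set q := Nat.card X with hq
  have hq1 : (1 : ℝ) < q := by exact_mod_cast Finite.one_lt_card
  have hC1 : (1 : ℝ) < C := by exact_mod_cast hC
  have ha : 0 < Real.logb C q := Real.logb_pos hC1 hq1
  -- The exponent satisfies `C ^ a = q`, so `n ≤ C ^ j` gives `n ^ a ≤ q ^ j`.
  refine ⟨Real.logb C q, ha, D * C + 1, by omega, fun n hn => ?_⟩
  set j := Nat.log C n + 1 with hj
  have hnj : n < C ^ j := Nat.lt_pow_succ_log_self hC n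
  have hjn : C ^ j ≤ C * n := by
    rw [hj, pow_succ']
    exact Nat.mul_le_mul_left C (Nat.pow_log_le_self C (by omega))
  obtain ⟨g, hg1, hg, hgd⟩ := hdepth j
  have h1 : ((2 ^ q ^ j : ℕ) : ℕ∞) ≤ rfGrowth S ((D * C + 1) * n) := by
    refine hgd.trans (le_iSup_of_le g (le_iSup_of_le hg1 (le_iSup_of_le ?_ le_rfl)))
    refine hg.trans ((Nat.mul_le_mul_left D hjn).trans ?_)
    rw [← mul_assoc]
    exact Nat.mul_le_mul_right n (Nat.le_succ _)
  refine le_trans ?_ (ENat.toENNReal_le.mpr h1)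
  have h2 : (n : ℝ) ^ Real.logb C q ≤ ((q ^ j : ℕ) : ℝ) := by
    calc (n : ℝ) ^ Real.logb C q ≤ ((C : ℝ) ^ (j : ℝ)) ^ Real.logb C q := by
          refine Real.rpow_le_rpow (by positivity) ?_ ha.le
          rw [Real.rpow_natCast]
          exact_mod_cast hnj.le
      _ = ((C : ℝ) ^ Real.logb C q) ^ (j : ℝ) := by
          rw [← Real.rpow_mul (by positivity), mul_comm, Real.rpow_mul (by positivity)]
      _ = ((q ^ j : ℕ) : ℝ) := by
          rw [Real.rpow_logb (by positivity) hC1.ne' (by positivity), Real.rpow_natCast]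
          push_cast
          rfl
  refine (ENNReal.rpow_le_rpow_of_exponent_le (by norm_num) h2).trans (le_of_eq ?_)
  rw [ENNReal.rpow_natCast, ENat.toENNReal_coe]
  push_cast
  rfl

end RootedTree

/-! ### Combining the two bounds. -/

open ResidualGrowth in
theorem ResidualGrowth.GrowthLE.of_le_left {f g h : ℕ → ℝ≥0∞} (hfg : ∀ n, f n ≤ g n)
    (H : GrowthLE g h) : GrowthLE f h :=
  H.imp fun _ hC => ⟨hC.1, fun n hn => (hfg n).trans (hC.2 n hn)⟩

open ResidualGrowth in
theorem ResidualGrowth.GrowthLE.of_le_right {f g h : ℕ → ℝ≥0∞} (H : GrowthLE f g)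
    (hgh : ∀ n, g n ≤ h n) : GrowthLE f h :=
  H.imp fun _ hC => ⟨hC.1, fun n hn => (hC.2 n hn).trans (hgh _)⟩

theorem mainTheorem3 {X : Type*} [Fintype X] (hX : 2 ≤ Fintype.card X)
    (H : Subgroup (RootedTree.TreeAut X)) (hfg : Group.FG H)
    (hji : ResidualGrowth.JustInfinite H) (hrb : RootedTree.RegularBranch H)
    (hcontr : RootedTree.Contracting H) (hcsp : RootedTree.CongruenceSubgroupProperty H)
    (S : Finset H) (hS : Subgroup.closure (S : Set H) = ⊤) :
    ResidualGrowth.NearExponential (ResidualGrowth.fullRFGrowth S) ∧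
      ResidualGrowth.NearExponential (ResidualGrowth.rfGrowth S) := by
  have : Nontrivial X := Fintype.one_lt_card_iff_nontrivial.mp hX
  have hle : ∀ n, (ResidualGrowth.rfGrowth S n : ℝ≥0∞) ≤ ResidualGrowth.fullRFGrowth S n :=
    fun n => ENat.toENNReal_le.mpr (ResidualGrowth.rfGrowth_le_fullRFGrowth S n)
  obtain ⟨a, ha, hlow⟩ := RootedTree.growthLE_expPow_rfGrowth hfg hji hrb hcontr.choose hcsp hS
  obtain ⟨b, hb, hup⟩ := RootedTree.growthLE_fullRFGrowth_expPow hcontr hS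
  exact ⟨⟨⟨a, ha, hlow.of_le_right hle⟩, ⟨b, hb, hup⟩⟩,
    ⟨⟨a, ha, hlow⟩, ⟨b, hb, hup.of_le_left hle⟩⟩⟩
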